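/- **Setting.** Let $X$ be a finite group, $G\le X$ a subgroup and $M\subset X$ with $e\in M$ a set of representatives of the cosets $Gx$, so every $x\in X$ is uniquely $x=gs$ with $g\in G$, $s\in M$. For $s,t\in M$, $u\in G$ write $st=\tau(s,t)(s\cdot t)$ and $su=(s\triangleright u)(s\triangleleft u)$ with $\tau(s,t),\,s\triangleright u\in G$ and $s\cdot t,\,s\triangleleft u\in M$; let $s^L\in M$ be the left inverse, $s^L\cdot s=e$. For $y\in X$ write $y=|y|^{-1}\langle y\rangle$ with $|y|\in G$, $\langle y\rangle\in M$, and put $y\tilde\triangleleft x=x^{-1}yx$, $\;y\tilde\triangleright x=\langle y\rangle\,x\,\langle y\tilde\triangleleft x\rangle^{-1}$, $\;y\circ z=|z|^{-1}y\langle z\rangle$, $\;\tilde\tau(y,z)=\tau(\langle y\rangle,\langle z\rangle)$. Assume that every $s\in M$ has a right inverse ($s\cdot p=e$ for some $p\in M$) and that for all $y,x\in X$ the equation $y\circ b=y\tilde\triangleleft x$ has a unique solution $b=:\|\delta_y\otimes x\|$ (both hold if $(M,\cdot)$ has right division). Let $k$ be a field. The category $\mathcal D$ has as objects the finite dimensional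 $k$-vector spaces $V$ with a right action $\hat\triangleleft$ of $X$ and an $X$-grading $\|\cdot\|$ such that $\|\xi\hat\triangleleft x\|=\|\xi\|\tilde\triangleleft x$; write $\langle\xi\rangle,|\xi|$ for $\langle\|\xi\|\rangle,|\|\xi\||$. Tensor products have $\|\xi\otimes\eta\|=\|\xi\|\circ\|\eta\|$ and $(\xi\otimes\eta)\hat\triangleleft x=\xi\hat\triangleleft(\|\eta\|\tilde\triangleright x)\otimes\eta\hat\triangleleft x$; the associator is $(\xi\otimes\eta)\otimes\zeta\mapsto\xi\hat\triangleleft\tilde\tau(\|\eta\|,\|\zeta\|)\otimes(\eta\otimes\zeta)$, the braiding is $\Psi(\xi\otimes\eta)=\eta\hat\triangleleft(\langle\xi\rangle\triangleleft|\eta|)^{-1}\otimes\xi\hat\triangleleft|\eta|$, and the ribbon element is $\theta(\xi)=\xi\hat\triangleleft\|\xi\|$. The dual $V^*$ is the dual space with $\|\alpha\|\circ\|\xi\|=e$ and $(\alpha\hat\triangleleft(\|\xi\|\tilde\triangleright x))(\xi\hat\triangleleft x)=\alpha(\xi)$; $\mathrm{ev}(\alpha\otimes\xi)=\alpha(\xi)$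 and $\mathrm{coev}(1)=\sum_i\xi_i\hat\triangleleft\tau(\langle\xi_i\rangle^L,\langle\xi_i\rangle)^{-1}\otimes\xi^i$ for a homogeneous basis $(\xi_i)$ with dual basis $(\xi^i)$. For a linear map $f:V\to V$ (not necessarily a morphism) put $$\mathrm{trace}(f)=\mathrm{ev}\circ\Psi\circ(\theta^{-1}f\otimes\mathrm{id})\circ\mathrm{coev}(1)\in k,\qquad \dim V=\mathrm{trace}(\mathrm{id}_V).$$ $D$ is the braided Hopf algebra in $\mathcal D$ with basis $\delta_y\otimes x$ ($y,x\in X$), grades $\|\delta_y\otimes x\|$, action $(\delta_y\otimes x)\hat\triangleleft z=\delta_{y\tilde\triangleleft(b\tilde\triangleright z)}\otimes(b\tilde\triangleright z)^{-1}xz$ where $b=\|\delta_y\otimes x\|$, product $(\delta_y\otimes x)(\delta_w\otimes z)=\delta_{w,\,y\tilde\triangleleft x}\;\delta_{y\tilde\triangleleft\tilde\tau(a,b)}\otimes\tilde\tau(a,b)^{-1}xz$ where $a=\|\delta_y\otimes x\|$, $b=\|\delta_w\otimes z\|$, and counit $\epsilon(\delta_y\otimes x)=\delta_{y,e}$. Every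 object $V$ of $\mathcal D$ is a right representation of $D$ by $\xi\triangleleft(\delta_y\otimes x)=\delta_{y,\|\xi\|}\,\xi\hat\triangleleft x$; these are the right representations considered. The coproduct $\Delta$ is the one for which the action on $V\otimes W$ is obtained from $\Delta$, the braiding of $W$ with $D$ and the actions on $V$ and $W$. Explicitly, $$\Delta(\delta_y\otimes x)=\sum_{z\in X}\big(\delta_{Tz^{-1}yT^{-1}}\otimes Tx\langle b\rangle^{-1}\big)\otimes\big(\delta_{r^{-1}zr}\otimes r^{-1}x\big),$$ where $c=\|\delta_y\otimes x\|$, $b=|c|^{-1}z^{-1}|c|\,x^{-1}zx$, $a=|b|\,c\,\langle b\rangle^{-1}$, $T=\tilde\tau(a,b)$ and $r=T^{-1}|a|$. The antipode is $S(\delta_y\otimes x)=\delta_{sx^{-1}y^{-1}xs^{-1}}\otimes sx^{-1}|a|$, where $a=\|\delta_y\otimes x\|$ and $s=\langle a\rangle$. Subrepresentations, irreducibility (non-zero and without proper non-zero subrepresentations) and isomorphism are taken with respect to the $D$-action. Let $\Lambda\in D$ be a right integral, i.e. $\Lambda\neq0$ and $\Lambda h=\epsilon(h)\Lambda$ for all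 $h\in D$. For representations $V,W$ and a linear map $t:V\to W$ (not necessarily a morphism) let $t_0:V\to W$ be the composite $$V\xrightarrow{\ \xi\mapsto\xi\otimes\Lambda\ }V\otimes D\xrightarrow{\mathrm{id}\otimes\Delta}V\otimes(D\otimes D)\xrightarrow{\mathrm{id}\otimes(S\otimes\mathrm{id})}V\otimes(D\otimes D)\to(V\otimes D)\otimes D\xrightarrow{\triangleleft\otimes\mathrm{id}}V\otimes D\xrightarrow{t\otimes\mathrm{id}}W\otimes D\xrightarrow{\ \triangleleft\ }W,$$ where the unlabelled arrow is the inverse associator. **Proposition.** Suppose $\epsilon(\Lambda)=1$. 1. If $V$ and $W$ are irreducible right representations of $D$ which are not isomorphic, then $t_0=0$ for every linear map $t:V\to W$. 2. Let $V$ be an irreducible right representation of $D$, and suppose that $k$ is algebraically closed or, more generally, that every endomorphism of the representation $V$ is a scalar. Then $\dim V\neq0$ in $k$, and for every linear map $t:V\to V$ $$t_0=c\,\mathrm{id}_V,\qquad c=\frac{\mathrm{trace}(t)}{\dim V}.$$ -/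

import Mathlib

open scoped TensorProduct

noncomputable section

namespace CosetCat

universe u v w w'

/-- A set `M` of representatives, containing `e`, for the cosets `G x` of a subgroup `G ≤ X`:
every `x ∈ X` factors uniquely as `x = g s` with `g ∈ G` and `s ∈ M`. -/
structure CosetReps (X : Type v) [Group X] where
  G : Subgroup X
  M : Set X
  isComplement : Subgroup.IsComplement (G : Set X) M
  one_mem : (1 : X) ∈ M

namespace CosetReps

variable {X : Type v} [Group X] (C : CosetReps X)

/-- the `G`-part `g` of `x = g s` -/
def gPart (x : X) : X := (C.isComplement.equiv x).1

/-- the `M`-part `s` of `x = g s`; for a grade `y = ‖ξ‖ = |ξ|⁻¹⟨ξ⟩` this is `⟨ξ⟩` -/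
def mPart (x : X) : X := (C.isComplement.equiv x).2

/-- for a grade `y = ‖ξ‖ = |ξ|⁻¹⟨ξ⟩`, the `G`-grade `|ξ|` -/
def absG (y : X) : X := (C.gPart y)⁻¹

/-- `τ(s,t) ∈ G`, where `s t = τ(s,t) (s · t)` -/
def tau (s t : X) : X := C.gPart (s * t)

/-- `s · t ∈ M`, where `s t = τ(s,t) (s · t)` -/
def dot (s t : X) : X := C.mPart (s * t)

/-- `s ◁ g ∈ M`, where `s g = (s ▷ g)(s ◁ g)` -/
def actM (s g : X) : X := C.mPart (s * g)

/-- the left inverse `s^L ∈ M` of `s ∈ M`, i.e. `s^L · s = e` -/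
def leftInv (s : X) : X := C.mPart s⁻¹

/-- the product of grades: `(v t) ∘ (w p) = w v t p` for `v, w ∈ G` and `t, p ∈ M` -/
def comp (y z : X) : X := C.gPart z * y * C.mPart z

/-- `y ▷~ x = t x t'⁻¹`, where `t = ⟨y⟩` and `t' = ⟨y ◁~ x⟩` with `y ◁~ x = x⁻¹ y x` -/
def tact (y x : X) : X := C.mPart y * x * (C.mPart (x⁻¹ * y * x))⁻¹

/-- The standing conditions on `M`: right inverses exist in `(M, ·)` (so that objects have duals),
and the equation `y ∘ b = y ◁~ x`, which defines the grade of the basis element `δ_y ⊗ x` of `D`,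
has exactly one solution `b`. Both hold if right division is possible in `(M, ·)`. -/
class Admissible : Prop where
  right_inv : ∀ s ∈ C.M, ∃ p ∈ C.M, C.dot s p = 1
  existsUnique_grade : ∀ y x : X, ∃! b : X, C.comp y b = x⁻¹ * y * x

theorem gPart_mem (x : X) : C.gPart x ∈ C.G := (C.isComplement.equiv x).1.2

theorem mPart_mem (x : X) : C.mPart x ∈ C.M := (C.isComplement.equiv x).2.2

theorem gPart_mul_mPart (x : X) : C.gPart x * C.mPart x = x :=
  C.isComplement.equiv_fst_mul_equiv_snd x

theorem parts_unique {g s : X} (hg : g ∈ C.G) (hs : s ∈ C.M) :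
    C.gPart (g * s) = g ∧ C.mPart (g * s) = s := by
  have h : (C.isComplement.equiv (g * s)) = (⟨g, hg⟩, ⟨s, hs⟩) := by
    rw [← Equiv.eq_symm_apply]
    rfl
  simp [gPart, mPart, h]

theorem mPart_eq_iff {x y : X} : C.mPart x = C.mPart y ↔ x * y⁻¹ ∈ C.G := by
  constructor
  · intro h
    have : x * y⁻¹ = C.gPart x * (C.gPart y)⁻¹ := by
      conv_lhs => rw [← C.gPart_mul_mPart x, ← C.gPart_mul_mPart y, h]
      group
    rw [this]
    exact C.G.mul_mem (C.gPart_mem x) (C.G.inv_mem (C.gPart_mem y))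
  · intro h
    have h1 : x = (x * y⁻¹ * C.gPart y) * C.mPart y := by
      rw [mul_assoc, C.gPart_mul_mPart]; group
    have h2 := (C.parts_unique (C.G.mul_mem h (C.gPart_mem y)) (C.mPart_mem y)).2
    rw [← h1] at h2
    exact h2

theorem mPart_of_mem {s : X} (hs : s ∈ C.M) : C.mPart s = s := by
  have := (C.parts_unique C.G.one_mem hs).2
  simpa using this

theorem mPart_eq_of {x s : X} (hs : s ∈ C.M) (h : x * s⁻¹ ∈ C.G) : C.mPart x = s := by
  rw [← C.mPart_of_mem hs, C.mPart_eq_iff]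
  exact h

theorem mPart_eq_one_iff {x : X} : C.mPart x = 1 ↔ x ∈ C.G := by
  have h1 := C.mPart_of_mem C.one_mem
  have := C.mPart_eq_iff (x := x) (y := 1)
  rw [h1] at this
  simpa using this

section Admissible

variable [Finite X] [C.Admissible]

theorem leftInv_injective {s t : X} (hs : s ∈ C.M) (ht : t ∈ C.M)
    (h : C.leftInv s = C.leftInv t) : s = t := by
  have hsurj : Function.Surjective
      (fun s : C.M => (⟨C.leftInv s, C.mPart_mem _⟩ : C.M)) := by
    rintro ⟨p, hp⟩
    obtain ⟨q, hq, hpq⟩ := Admissible.right_inv (C := C) p hp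
    refine ⟨⟨q, hq⟩, Subtype.ext ?_⟩
    have : p * q ∈ C.G := C.mPart_eq_one_iff.1 hpq
    refine C.mPart_eq_of hp ?_
    simpa using C.G.inv_mem this
  have := Finite.injective_iff_surjective.2 hsurj
  have h' := @this ⟨s, hs⟩ ⟨t, ht⟩ (Subtype.ext h)
  exact congrArg Subtype.val h'

theorem existsUnique_rPart (x : X) : ∃! t : X, t ∈ C.M ∧ x⁻¹ * t ∈ C.G := by
  obtain ⟨p, hp, h⟩ := Admissible.right_inv (C := C) (C.mPart x⁻¹) (C.mPart_mem _)
  have key : ∀ t : X, x⁻¹ * t ∈ C.G ↔ C.mPart t⁻¹ = C.mPart x⁻¹ := by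
    intro t
    rw [C.mPart_eq_iff, inv_inv, ← C.G.inv_mem_iff]
    simp
  have hp' : x⁻¹ * p ∈ C.G := by
    rw [key]
    have h1 : C.mPart x⁻¹ * p ∈ C.G := C.mPart_eq_one_iff.1 h
    refine C.mPart_eq_of (C.mPart_mem _) ?_
    simpa using C.G.inv_mem h1
  refine ⟨p, ⟨hp, hp'⟩, ?_⟩
  rintro t ⟨ht, ht'⟩
  exact C.leftInv_injective ht hp (by unfold leftInv; rw [(key t).1 ht', (key p).1 hp'])

/-- the unique element of `M` lying in `x G` -/
def rPart (x : X) : X := (C.existsUnique_rPart x).choose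

theorem rPart_mem (x : X) : C.rPart x ∈ C.M := (C.existsUnique_rPart x).choose_spec.1.1

theorem rPart_spec (x : X) : x⁻¹ * C.rPart x ∈ C.G := (C.existsUnique_rPart x).choose_spec.1.2

theorem rPart_eq {x t : X} (ht : t ∈ C.M) (h : x⁻¹ * t ∈ C.G) : C.rPart x = t :=
  ((C.existsUnique_rPart x).choose_spec.2 t ⟨ht, h⟩).symm

end Admissible

/-- the grade `‖δ_y ⊗ x‖`, defined by `y ∘ ‖δ_y ⊗ x‖ = y ◁~ x` -/
def gradeD [C.Admissible] (y x : X) : X :=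
  (Admissible.existsUnique_grade (C := C) y x).choose

theorem comp_gradeD [C.Admissible] (y x : X) : C.comp y (C.gradeD y x) = x⁻¹ * y * x :=
  (Admissible.existsUnique_grade (C := C) y x).choose_spec.1

theorem gradeD_eq [C.Admissible] {y x b : X} (h : C.comp y b = x⁻¹ * y * x) :
    C.gradeD y x = b :=
  ((Admissible.existsUnique_grade (C := C) y x).choose_spec.2 b h).symm

/-- the grade of a functional supported on the component of grade `y`; it is the solution `l` of
`l ∘ y = e`, and `⟨l⟩ = ⟨y⟩^L` -/
def dualGrade (y : X) : X := (C.mPart y * C.gPart y)⁻¹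

theorem comp_dualGrade (y : X) : C.comp (C.dualGrade y) y = 1 := by
  simp only [comp, dualGrade]
  group

theorem mPart_dualGrade (y : X) : C.mPart (C.dualGrade y) = C.leftInv (C.mPart y) := by
  unfold leftInv dualGrade
  rw [C.mPart_eq_iff]
  simpa using C.gPart_mem y

section DualShift

variable [Finite X] [C.Admissible]

/-- the element `x⁻¹`, where `x` is determined by `(x y x⁻¹) ▷~ x = g` -/
def dualShift (g y : X) : X := (C.mPart y)⁻¹ * g⁻¹ * C.rPart (g * (C.dualGrade y)⁻¹ * g⁻¹)

theorem parts_dualShift (g y : X) :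
    C.mPart ((C.dualShift g y)⁻¹ * y * C.dualShift g y)
        = C.rPart (g * (C.dualGrade y)⁻¹ * g⁻¹) ∧
      C.dualGrade ((C.dualShift g y)⁻¹ * y * C.dualShift g y) = g * C.dualGrade y * g⁻¹ := by
  set t := C.rPart (g * (C.dualGrade y)⁻¹ * g⁻¹) with ht
  have hy : C.gPart y = y * (C.mPart y)⁻¹ := eq_mul_inv_of_mul_eq (C.gPart_mul_mPart y)
  have e : (C.dualShift g y)⁻¹ * y * C.dualShift g y
      = t⁻¹ * (g * (C.dualGrade y)⁻¹ * g⁻¹) * t := by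
    have h0 : C.dualShift g y = (C.mPart y)⁻¹ * g⁻¹ * t := rfl
    rw [h0]
    clear_value t
    simp only [dualGrade, hy]
    group
  have hG : t⁻¹ * (g * (C.dualGrade y)⁻¹ * g⁻¹) ∈ C.G := by
    have := C.G.inv_mem (C.rPart_spec (g * (C.dualGrade y)⁻¹ * g⁻¹))
    simpa only [← ht, mul_inv_rev, inv_inv] using this
  have hp := C.parts_unique hG (C.rPart_mem (g * (C.dualGrade y)⁻¹ * g⁻¹))
  rw [← ht, ← e] at hp
  refine ⟨hp.2, ?_⟩
  unfold dualGrade at *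
  rw [hp.1, hp.2]
  group

theorem dualShift_one (y : X) : C.dualShift 1 y = 1 := by
  have : C.rPart (1 * (C.dualGrade y)⁻¹ * 1⁻¹) = C.mPart y := by
    apply C.rPart_eq (C.mPart_mem y)
    have := C.G.inv_mem (C.gPart_mem y)
    simpa [dualGrade] using this
  rw [dualShift, this]
  group

theorem dualShift_mul (g h y : X) :
    C.dualShift (g * h) y
      = C.dualShift h y * C.dualShift g ((C.dualShift h y)⁻¹ * y * C.dualShift h y) := by
  obtain ⟨h1, h2⟩ := C.parts_dualShift h y
  have e : g * (h * C.dualGrade y * h⁻¹)⁻¹ * g⁻¹ = g * h * (C.dualGrade y)⁻¹ * (g * h)⁻¹ := by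
    group
  have h3 : C.dualShift g ((C.dualShift h y)⁻¹ * y * C.dualShift h y)
      = (C.rPart (h * (C.dualGrade y)⁻¹ * h⁻¹))⁻¹ * g⁻¹
        * C.rPart (g * h * (C.dualGrade y)⁻¹ * (g * h)⁻¹) := by
    rw [dualShift, h1, h2, e]
  rw [h3]
  unfold dualShift
  group

theorem dualShift_tact (x y : X) : C.dualShift (C.tact y x) (x⁻¹ * y * x) = x⁻¹ := by
  have hy : C.gPart (x⁻¹ * y * x) = (x⁻¹ * y * x) * (C.mPart (x⁻¹ * y * x))⁻¹ :=
    eq_mul_inv_of_mul_eq (C.gPart_mul_mPart _)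
  have : C.rPart (C.tact y x * (C.dualGrade (x⁻¹ * y * x))⁻¹ * (C.tact y x)⁻¹) = C.mPart y := by
    apply C.rPart_eq (C.mPart_mem y)
    have e : (C.tact y x * (C.dualGrade (x⁻¹ * y * x))⁻¹ * (C.tact y x)⁻¹)⁻¹ * C.mPart y
        = (C.gPart y)⁻¹ := by
      have hy' : C.gPart y = y * (C.mPart y)⁻¹ := eq_mul_inv_of_mul_eq (C.gPart_mul_mPart y)
      simp only [tact, dualGrade, hy, hy']
      group
    rw [e]
    exact C.G.inv_mem (C.gPart_mem y)
  rw [dualShift, this, tact]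
  group

end DualShift

theorem tact_one (b : X) : C.tact b 1 = 1 := by simp [tact]

theorem tact_mul (b x y : X) :
    C.tact b (x * y) = C.tact b x * C.tact (x⁻¹ * b * x) y := by
  simp only [tact, mul_inv_rev]
  have : y⁻¹ * (x⁻¹ * b * x) * y = y⁻¹ * x⁻¹ * b * (x * y) := by group
  rw [this]
  group

theorem comp_conj (y b z : X) :
    C.comp ((C.tact b z)⁻¹ * y * C.tact b z) (z⁻¹ * b * z) = z⁻¹ * C.comp y b * z := by
  have hb : C.gPart b = b * (C.mPart b)⁻¹ := eq_mul_inv_of_mul_eq (C.gPart_mul_mPart b)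
  have hb' : C.gPart (z⁻¹ * b * z) = (z⁻¹ * b * z) * (C.mPart (z⁻¹ * b * z))⁻¹ :=
    eq_mul_inv_of_mul_eq (C.gPart_mul_mPart _)
  simp only [comp, tact, hb, hb']
  group

theorem gradeD_act [C.Admissible] (y x z : X) :
    C.gradeD ((C.tact (C.gradeD y x) z)⁻¹ * y * C.tact (C.gradeD y x) z)
      ((C.tact (C.gradeD y x) z)⁻¹ * x * z) = z⁻¹ * C.gradeD y x * z := by
  apply C.gradeD_eq
  rw [C.comp_conj, C.comp_gradeD]
  group

end CosetReps

/-- An object of the category `𝒟`: a finite dimensional `k`-vector space with a right action `◁^` of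
`X` and an `X`-grading satisfying `‖ξ ◁^ x‖ = x⁻¹ ‖ξ‖ x`. Here `act x ξ` is `ξ ◁^ x` and
`proj y` is the projection onto the component of grade `y`. -/
structure Obj (k : Type u) [Field k] (X : Type v) [Group X] [Fintype X] [DecidableEq X] where
  carrier : Type w
  [addCommGroup : AddCommGroup carrier]
  [module : Module k carrier]
  [finite : Module.Finite k carrier]
  act : X → carrier →ₗ[k] carrier
  proj : X → carrier →ₗ[k] carrier
  act_one : ∀ ξ, act 1 ξ = ξ
  act_mul : ∀ x y ξ, act (x * y) ξ = act y (act x ξ)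
  proj_proj : ∀ y z ξ, proj y (proj z ξ) = if y = z then proj z ξ else 0
  sum_proj : ∀ ξ, ∑ y, proj y ξ = ξ
  act_proj : ∀ x y ξ, act x (proj y ξ) = proj (x⁻¹ * y * x) (act x ξ)

attribute [instance] Obj.addCommGroup Obj.module Obj.finite

variable {k : Type u} [Field k] {X : Type v} [Group X] [Fintype X] [DecidableEq X]

instance : CoeSort (Obj.{u, v, w} k X) (Type w) := ⟨Obj.carrier⟩

/-! ### The braided Hopf algebra `D` -/

/-- the vector space `D` with basis `δ_y ⊗ x`, `(y, x) ∈ X × X` -/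
abbrev DAlg (k : Type u) [Field k] (X : Type v) : Type (max u v) := X × X →₀ k

/-- the basis element `δ_y ⊗ x` of `D` -/
abbrev dl (k : Type u) [Field k] (y x : X) : DAlg k X := Finsupp.single (y, x) 1

variable (C : CosetReps X) [C.Admissible]

/-- `D` as an object of `𝒟`: `(δ_y ⊗ x) ◁^ z = δ_{y ◁~ (b ▷~ z)} ⊗ (b ▷~ z)⁻¹ x z`,
where `b = ‖δ_y ⊗ x‖`. -/
def dObj (k : Type u) [Field k] : Obj.{u, v, max u v} k X where
  carrier := DAlg k X
  act z := Finsupp.linearCombination k fun a : X × X =>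
    let q := C.tact (C.gradeD a.1 a.2) z
    dl k (q⁻¹ * a.1 * q) (q⁻¹ * a.2 * z)
  proj b := Finsupp.linearCombination k fun a : X × X =>
    if C.gradeD a.1 a.2 = b then dl k a.1 a.2 else 0
  act_one ξ := by
    induction ξ using Finsupp.induction_linear with
    | zero => simp
    | add f g hf hg => simp only [map_add, hf, hg]
    | single a r => simp [C.tact_one]
  act_mul x y ξ := by
    induction ξ using Finsupp.induction_linear with
    | zero => simp
    | add f g hf hg => simp only [map_add, hf, hg]
    | single a r =>
      simp only [Finsupp.linearCombination_single, map_smul, one_smul]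
      rw [C.gradeD_act, C.tact_mul]
      refine congrArg (fun p : X × X => r • Finsupp.single p (1 : k)) (Prod.ext ?_ ?_) <;>
        dsimp only <;> group
  proj_proj y z ξ := by
    induction ξ using Finsupp.induction_linear with
    | zero => simp
    | add f g hf hg => simp only [map_add, hf, hg]; split_ifs <;> simp
    | single a r =>
      simp only [Finsupp.linearCombination_single, map_smul]
      by_cases h : C.gradeD a.1 a.2 = z
      · subst h
        by_cases h2 : y = C.gradeD a.1 a.2
        · simp [h2]
        · simp [h2, Ne.symm h2]
      · simp [h]
  sum_proj ξ := by
    induction ξ using Finsupp.induction_linear with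
    | zero => simp
    | add f g hf hg => simp only [map_add, Finset.sum_add_distrib, hf, hg]
    | single a r =>
      simp only [Finsupp.linearCombination_single]
      rw [← Finset.smul_sum]
      simp
  act_proj x y ξ := by
    induction ξ using Finsupp.induction_linear with
    | zero => simp
    | add f g hf hg => simp only [map_add, hf, hg]
    | single a r =>
      simp only [Finsupp.linearCombination_single, map_smul, one_smul]
      rw [C.gradeD_act]
      by_cases h : C.gradeD a.1 a.2 = y
      · simp [h]
      · have h' : ¬ (x⁻¹ * C.gradeD a.1 a.2 * x = x⁻¹ * y * x) := by simpa using h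
        simp [h, h']

/-- the product of `D`: `(δ_y ⊗ x)(δ_w ⊗ z) = δ_{w, y ◁~ x} δ_{y ◁~ τ~(a,b)} ⊗ τ~(a,b)⁻¹ x z`,
where `a = ‖δ_y ⊗ x‖`, `b = ‖δ_w ⊗ z‖` and `τ~(a,b) = τ(⟨a⟩,⟨b⟩)` -/
def mulD : DAlg k X →ₗ[k] DAlg k X →ₗ[k] DAlg k X :=
  Finsupp.linearCombination k fun a : X × X => Finsupp.linearCombination k fun b : X × X =>
    let T := C.tau (C.mPart (C.gradeD a.1 a.2)) (C.mPart (C.gradeD b.1 b.2))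
    if b.1 = a.2⁻¹ * a.1 * a.2 then dl k (T⁻¹ * a.1 * T) (T⁻¹ * a.2 * b.2) else 0

/-- the counit of `D`: `ε(δ_y ⊗ x) = δ_{y,e}` -/
def counitD : DAlg k X →ₗ[k] k :=
  Finsupp.linearCombination k fun a : X × X => if a.1 = 1 then 1 else 0

/-- The coproduct of `D`, the one for which the action of `D` on a tensor product `V ⊗ W` in `𝒟` is
`V ⊗ W ⊗ D → V ⊗ W ⊗ D ⊗ D → V ⊗ D ⊗ W ⊗ D → V ⊗ W` (coproduct, braiding of `W` with `D`, actions;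
associators suppressed). With `c = ‖δ_y ⊗ x‖` it is the sum over `z ∈ X` (the grade of the factor in
`W`) of `(δ_{T z⁻¹ y T⁻¹} ⊗ T x ⟨b⟩⁻¹) ⊗ (δ_{z ◁~ r} ⊗ r⁻¹ x)`, where `a` and `b` are the
grades of the two tensor factors, `T = τ(⟨a⟩,⟨b⟩)` and `r = T⁻¹ |a|`. -/
def comulD : DAlg k X →ₗ[k] DAlg k X ⊗[k] DAlg k X :=
  Finsupp.linearCombination k fun h : X × X => ∑ z : X,
    let y := h.1
    let x := h.2
    let c := C.gradeD y x
    let b := (C.absG c)⁻¹ * z⁻¹ * C.absG c * x⁻¹ * z * x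
    let a := C.absG b * c * (C.mPart b)⁻¹
    let T := C.tau (C.mPart a) (C.mPart b)
    let r := T⁻¹ * C.absG a
    dl k (T * z⁻¹ * y * T⁻¹) (T * x * (C.mPart b)⁻¹) ⊗ₜ[k] dl k (r⁻¹ * z * r) (r⁻¹ * x)

/-- the antipode of `D`: `S(δ_y ⊗ x) = δ_{s x⁻¹ y⁻¹ x s⁻¹} ⊗ s x⁻¹ |a|`, where `a = ‖δ_y ⊗ x‖` and
`s = ⟨a⟩` -/
def antipodeD : DAlg k X →ₗ[k] DAlg k X :=
  Finsupp.linearCombination k fun h : X × X =>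
    let y := h.1
    let x := h.2
    let a := C.gradeD y x
    let s := C.mPart a
    dl k (s * x⁻¹ * y⁻¹ * x * s⁻¹) (s * x⁻¹ * C.absG a)

/-- a right integral of `D`: a non-zero element `Λ` with `Λ h = ε(h) Λ` for all `h` -/
def IsRightIntegral (L : DAlg k X) : Prop :=
  L ≠ 0 ∧ ∀ h : DAlg k X, mulD C L h = counitD h • L

/-! ### Representations of `D` -/

/-- The right action `V ⊗ D → V` of `D` on an object of `𝒟`,
`ξ ◁^ (δ_y ⊗ x) = δ_{y,‖ξ‖} ξ ◁^ x`. Through it the objects of `𝒟` are the right representations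
of `D`. -/
def actD (V : Obj.{u, v, w} k X) : V ⊗[k] DAlg k X →ₗ[k] V :=
  TensorProduct.lift (LinearMap.flip
    (Finsupp.linearCombination k fun a : X × X => V.act a.2 ∘ₗ V.proj a.1))

/-- `f` commutes with the actions of `D`, i.e. `f` is a morphism of right representations -/
def IsMorphism {V : Obj.{u, v, w} k X} {W : Obj.{u, v, w'} k X} (f : V →ₗ[k] W) : Prop :=
  ∀ (ξ : V) (h : DAlg k X), f (actD V (ξ ⊗ₜ h)) = actD W (f ξ ⊗ₜ h)

/-- isomorphism of right representations of `D` -/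
def Isomorphic (V : Obj.{u, v, w} k X) (W : Obj.{u, v, w'} k X) : Prop :=
  ∃ e : V ≃ₗ[k] W, IsMorphism (e : V →ₗ[k] W)

/-- a subrepresentation: a subspace stable under the action of `D` -/
def IsSubrep (V : Obj.{u, v, w} k X) (U : Submodule k V) : Prop :=
  ∀ ξ ∈ U, ∀ h : DAlg k X, actD V (ξ ⊗ₜ h) ∈ U

/-- irreducible right representations of `D` -/
def IsIrreducible (V : Obj.{u, v, w} k X) : Prop :=
  Nontrivial V ∧ ∀ U : Submodule k V, IsSubrep V U → U = ⊥ ∨ U = ⊤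

/-! ### Associator, braiding, twist, duals and the braided trace -/

/-- the inverse associator `V ⊗ (W ⊗ Z) → (V ⊗ W) ⊗ Z`,
`ξ ⊗ (η ⊗ ζ) ↦ (ξ ◁^ τ(⟨η⟩,⟨ζ⟩)⁻¹ ⊗ η) ⊗ ζ` -/
def assocInv (V : Obj.{u, v, w} k X) (W Z : Obj k X) :
    V ⊗[k] (W ⊗[k] Z) →ₗ[k] (V ⊗[k] W) ⊗[k] Z :=
  (∑ y : X, ∑ z : X, TensorProduct.map
    (TensorProduct.map (V.act (C.tau (C.mPart y) (C.mPart z))⁻¹) (W.proj y)) (Z.proj z)) ∘ₗ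
    (TensorProduct.assoc k V W Z).symm.toLinearMap

/-- the braiding `Ψ : V ⊗ W → W ⊗ V`, `ξ ⊗ η ↦ η ◁^ (⟨ξ⟩ ◁ |η|)⁻¹ ⊗ ξ ◁^ |η|` -/
def braid (V W : Obj k X) : V ⊗[k] W →ₗ[k] W ⊗[k] V :=
  (∑ y : X, ∑ z : X, TensorProduct.map
    (W.act (C.actM (C.mPart y) (C.absG z))⁻¹ ∘ₗ W.proj z) (V.act (C.absG z) ∘ₗ V.proj y)) ∘ₗ
    (TensorProduct.comm k V W).toLinearMap

/-- the ribbon element (twist) `θ`, `θ(ξ) = ξ ◁^ ‖ξ‖` -/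
def twist (V : Obj.{u, v, w} k X) : V →ₗ[k] V := ∑ y : X, V.act y ∘ₗ V.proj y

/-- `θ⁻¹`, `θ⁻¹(ξ) = ξ ◁^ ‖ξ‖⁻¹` -/
def twistInv (V : Obj.{u, v, w} k X) : V →ₗ[k] V := ∑ y : X, V.act y⁻¹ ∘ₗ V.proj y

theorem ext_proj {V : Obj.{u, v, w} k X} {N : Type*} [AddCommGroup N] [Module k N]
    {f g : V →ₗ[k] N} (h : ∀ y ξ, f (V.proj y ξ) = g (V.proj y ξ)) : f = g := by
  ext ξ
  rw [← V.sum_proj ξ, map_sum, map_sum]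
  exact Finset.sum_congr rfl fun y _ => h y ξ

theorem sum_apply_proj (V : Obj.{u, v, w} k X) {N : Type*} [AddCommGroup N] [Module k N]
    (F : X → V →ₗ[k] N) (y : X) (ξ : V) :
    (∑ z : X, F z ∘ₗ V.proj z) (V.proj y ξ) = F y (V.proj y ξ) := by
  rw [LinearMap.sum_apply, Finset.sum_eq_single y]
  · simp [V.proj_proj]
  · intro z _ hz
    simp [V.proj_proj, hz]
  · simp

theorem twist_comp_twistInv (V : Obj.{u, v, w} k X) :
    twist V ∘ₗ twistInv V = LinearMap.id ∧ twistInv V ∘ₗ twist V = LinearMap.id := by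
  constructor <;> refine ext_proj fun y ξ => ?_ <;>
    simp only [twist, twistInv, LinearMap.comp_apply, LinearMap.id_apply, sum_apply_proj]
  · have h : V.act y⁻¹ (V.proj y ξ) = V.proj y (V.act y⁻¹ ξ) := by
      rw [V.act_proj]; congr 2; group
    rw [h, sum_apply_proj, ← h, ← V.act_mul, inv_mul_cancel, V.act_one]
  · have h : V.act y (V.proj y ξ) = V.proj y (V.act y ξ) := by
      rw [V.act_proj]; congr 2; group
    rw [h, sum_apply_proj (F := fun y => V.act y⁻¹), ← h, ← V.act_mul, mul_inv_cancel,
      V.act_one]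

theorem act_proj' (V : Obj.{u, v, w} k X) (x y : X) (ξ : V) :
    V.act x (V.proj y ξ) = V.proj (x⁻¹ * y * x) (V.act x (V.proj y ξ)) := by
  rw [← V.act_proj, V.proj_proj, if_pos rfl]

theorem proj_proj_if (V : Obj.{u, v, w} k X) (p : X → Prop) [DecidablePred p] (y : X) (ξ : V) :
    (∑ z : X, if p z then V.proj z else 0) (V.proj y ξ) = if p y then V.proj y ξ else 0 := by
  rw [LinearMap.sum_apply, Finset.sum_eq_single y]
  · split_ifs <;> simp [V.proj_proj]
  · intro z _ hz
    split_ifs <;> simp [V.proj_proj, hz]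
  · simp

/-- The dual object `V*`: a functional supported on grade `y` has grade `l` with `l ∘ y = e`, and
the action is the one for which evaluation `V* ⊗ V → k` is invariant,
`(α ◁^ (‖ξ‖ ▷~ x))(ξ ◁^ x) = α(ξ)`. -/
def dualObj (V : Obj.{u, v, w} k X) : Obj.{u, v, max u w} k X where
  carrier := Module.Dual k V
  act g := (∑ y : X, V.act (C.dualShift g y) ∘ₗ V.proj y).dualMap
  proj l := (∑ y : X, if C.dualGrade y = l then V.proj y else 0).dualMap
  act_one α := by
    refine ext_proj fun y ξ => ?_
    simp only [LinearMap.dualMap_apply]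
    rw [sum_apply_proj, C.dualShift_one, V.act_one]
  act_mul x y α := by
    refine ext_proj fun z ξ => ?_
    simp only [LinearMap.dualMap_apply]
    rw [sum_apply_proj, sum_apply_proj, act_proj' V (C.dualShift y z), sum_apply_proj,
      ← act_proj', ← V.act_mul, C.dualShift_mul]
  proj_proj y z α := by
    refine ext_proj fun a ξ => ?_
    have h : ∀ (β : Module.Dual k V) (l : X),
        ((∑ y : X, if C.dualGrade y = l then V.proj y else 0).dualMap β) (V.proj a ξ)
          = if C.dualGrade a = l then β (V.proj a ξ) else 0 := by
      intro β l
      rw [LinearMap.dualMap_apply, proj_proj_if V (fun y => C.dualGrade y = l)]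
      split_ifs <;> simp
    rw [h, h]
    by_cases h1 : y = z
    · subst h1
      rw [if_pos rfl, h]
      split_ifs <;> rfl
    · rw [if_neg h1]
      by_cases h2 : C.dualGrade a = y
      · subst h2
        simp [h1]
      · simp [h2]
  sum_proj α := by
    refine ext_proj fun a ξ => ?_
    rw [LinearMap.sum_apply]
    simp only [LinearMap.dualMap_apply]
    rw [Finset.sum_eq_single (C.dualGrade a)]
    · rw [proj_proj_if V (fun y => C.dualGrade y = C.dualGrade a), if_pos rfl]
    · intro l _ hl
      rw [proj_proj_if V (fun y => C.dualGrade y = l), if_neg (Ne.symm hl), map_zero]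
    · simp
  act_proj x l α := by
    refine ext_proj fun a ξ => ?_
    simp only [LinearMap.dualMap_apply]
    rw [sum_apply_proj, proj_proj_if V (fun y => C.dualGrade y = x⁻¹ * l * x), act_proj',
      proj_proj_if V (fun y => C.dualGrade y = l), ← act_proj', (C.parts_dualShift x a).2]
    by_cases h : C.dualGrade a = x⁻¹ * l * x
    · have h' : x * C.dualGrade a * x⁻¹ = l := by rw [h]; group
      rw [if_pos h, if_pos h', sum_apply_proj]
    · have h' : ¬ (x * C.dualGrade a * x⁻¹ = l) := by
        rintro rfl
        exact h (by group)
      rw [if_neg h, if_neg h', map_zero, map_zero, map_zero]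

/-- invariance of evaluation under the action on `V* ⊗ V` -/
theorem dualObj_act_apply (V : Obj.{u, v, w} k X) (α : Module.Dual k V) (x y : X) (ξ : V) :
    (show Module.Dual k V from (dualObj C V).act (C.tact y x) α) (V.act x (V.proj y ξ))
      = α (V.proj y ξ) := by
  change ((∑ z : X, V.act (C.dualShift (C.tact y x) z) ∘ₗ V.proj z).dualMap α) _ = _
  rw [LinearMap.dualMap_apply, act_proj', sum_apply_proj, ← act_proj', ← V.act_mul,
    C.dualShift_tact, mul_inv_cancel, V.act_one]

/-- evaluation `V* ⊗ V → k` -/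
def ev (V : Obj.{u, v, w} k X) : dualObj C V ⊗[k] V →ₗ[k] k := contractLeft k V

/-- the value at `1` of the coevaluation `k → V ⊗ V*`: `∑ ξ_i ◁^ τ(⟨ξ_i⟩^L,⟨ξ_i⟩)⁻¹ ⊗ ξ^i` over a
homogeneous basis `ξ_i` of `V` and its dual basis `ξ^i` -/
def coev (V : Obj.{u, v, w} k X) : V ⊗[k] dualObj C V :=
  TensorProduct.map
    (∑ y : X, V.act (C.tau (C.leftInv (C.mPart y)) (C.mPart y))⁻¹ ∘ₗ V.proj y) LinearMap.id
    (coevaluation k V 1)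

/-- the braided trace of a linear map `f : V → V` (not necessarily a morphism): the value at `1` of
`k → V ⊗ V* → V ⊗ V* → V* ⊗ V → k`, composed of coevaluation, `θ⁻¹ f ⊗ id`, braiding and
evaluation -/
def trace (V : Obj.{u, v, w} k X) (f : V →ₗ[k] V) : k :=
  ev C V (braid C V (dualObj C V)
    (TensorProduct.map (twistInv V ∘ₗ f) LinearMap.id (coev C V)))

/-- the dimension of `V` in the ribbon category `𝒟`, the braided trace of the identity -/
def dim (V : Obj.{u, v, w} k X) : k := trace C V LinearMap.id

/-- The average `t₀ : V → W` of a linear map `t : V → W` (not necessarily a morphism), with respect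
to `Λ ∈ D`: `V → V ⊗ D → V ⊗ (D ⊗ D) → V ⊗ (D ⊗ D) → (V ⊗ D) ⊗ D → V ⊗ D → W ⊗ D → W`, composed of
`ξ ↦ ξ ⊗ Λ`, the coproduct, the antipode on the first factor `D`, the inverse associator, the action
on `V`, `t`, and the action on `W`; that is `t₀(ξ) = t(ξ ◁ S(Λ₁)) ◁ Λ₂` up to the associator. -/
def average (L : DAlg k X) {V : Obj.{u, v, w} k X} {W : Obj.{u, v, w'} k X} (t : V →ₗ[k] W) :
    V →ₗ[k] W :=
  actD W
    ∘ₗ TensorProduct.map t LinearMap.id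
    ∘ₗ TensorProduct.map (actD V) LinearMap.id
    ∘ₗ assocInv C V (dObj C k) (dObj C k)
    ∘ₗ TensorProduct.map LinearMap.id (TensorProduct.map (antipodeD C) LinearMap.id)
    ∘ₗ TensorProduct.map LinearMap.id (comulD C)
    ∘ₗ (TensorProduct.mk k V (DAlg k X)).flip L

end CosetCat

end

noncomputable section

namespace CosetCat

universe u v w w'

/-! ### Arithmetic of grades and of their duals -/

namespace CosetReps

variable {X : Type v} [Group X] (C : CosetReps X)

/-! In spite of the non-trivial associator, braiding and coevaluation, the statement is the
orthogonality argument for a finite group combined with a grading.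

Multiplying a right integral by `δ_e ⊗ z` on the right shows that it is `λ ∑ δ_e ⊗ x`
(`IsRightIntegral.eq_smul_sum`), and `ε(Λ) = 1` means `λ |X| = 1`. On vectors of grade `w` the
average of `t` against a single `δ_e ⊗ x` is the conjugate, under the group element `shear w x`, of
the grade-preserving part of `t` (`average_dl_one`). For fixed `w` the map `x ↦ shear w x` is a
permutation of `X`, so `t₀ = λ ∑ u ⁻¹`-conjugates over all `u ∈ X`, that is `λ • conjSum t`
(`IsRightIntegral.average_eq`). Such a sum commutes with `X` and with the grading, hence with `D`,
and Schur's lemma applies: `t₀` is zero or an isomorphism in the first claim, a scalar `c` in the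
second.

To find `c`, the braided trace is shown to be the ordinary trace (`trace_eq`). Neither taking the
grade-preserving part nor conjugating changes the ordinary trace, so `t₀` has trace `λ |X| tr(t) =
tr(t)`, and `c dim V = trace(t)`. A rank one `t` of trace `1` then forces `dim V ≠ 0`, whatever the
characteristic. -/

theorem parts_one : C.gPart 1 = 1 ∧ C.mPart 1 = 1 := by
  simpa using C.parts_unique C.G.one_mem C.one_mem

theorem absG_inv (y : X) : (C.absG y)⁻¹ = C.gPart y := inv_inv _

theorem absG_mem (y : X) : C.absG y ∈ C.G := C.G.inv_mem (C.gPart_mem y)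

theorem mPart_eq_absG_mul (y : X) : C.mPart y = C.absG y * y :=
  eq_inv_mul_of_mul_eq (C.gPart_mul_mPart y)

theorem comp_eq (y z : X) : C.comp y z = (C.absG z)⁻¹ * y * (C.absG z * z) := by
  rw [comp, C.absG_inv, C.mPart_eq_absG_mul]

theorem dualGrade_eq (y : X) : C.dualGrade y = C.absG y * (C.mPart y)⁻¹ := by
  simp [dualGrade, absG]

theorem comp_one_left (b : X) : C.comp 1 b = b := by
  simp [comp, C.gPart_mul_mPart]

theorem gradeD_one_left [C.Admissible] (x : X) : C.gradeD 1 x = 1 :=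
  C.gradeD_eq (by simp [C.comp_one_left])

/-- the factor `τ(⟨y⟩^L, ⟨y⟩)` is the product `⟨l⟩⟨y⟩`, where `l` is the dual grade of `y` -/
theorem tau_leftInv (y : X) :
    C.tau (C.leftInv (C.mPart y)) (C.mPart y) = C.mPart (C.dualGrade y) * C.mPart y := by
  rw [C.mPart_dualGrade]
  have h : C.leftInv (C.mPart y) * C.mPart y ∈ C.G := by
    have := (C.mPart_eq_iff (x := C.leftInv (C.mPart y)) (y := (C.mPart y)⁻¹)).1
      (C.mPart_of_mem (C.mPart_mem _))
    simpa using this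
  simpa [tau] using (C.parts_unique h C.one_mem).1

theorem rPart_dualGrade_inv [Finite X] [C.Admissible] (y : X) :
    C.rPart (C.dualGrade y)⁻¹ = C.mPart y :=
  C.rPart_eq (C.mPart_mem y) (by simpa [dualGrade] using C.gPart_mem y)

/-- The inverse of the dual grade is `⟨y⟩ |y|⁻¹`. Existence of right inverses makes the
factorization with the `M`-part on the left unique as well, so both parts of `y` can be recovered.
-/
theorem dualGrade_injective [Finite X] [C.Admissible] : Function.Injective C.dualGrade := by
  intro y z h
  have hm : C.mPart y = C.mPart z := by
    rw [← C.rPart_dualGrade_inv, ← C.rPart_dualGrade_inv, h]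
  have h2 := h
  rw [dualGrade, dualGrade, hm] at h2
  have hg : C.gPart y = C.gPart z := by simpa using h2
  rw [← C.gPart_mul_mPart y, ← C.gPart_mul_mPart z, hm, hg]

/-- Since `⟨y⟩ = |y| y`, the dual grade is `⟨y⟩ y⁻¹ ⟨y⟩⁻¹`; applied twice, the inversions cancel and
the conjugations compose. The conjugating element is the factor in the coevaluation, which therefore
moves a vector of grade `y` to its double dual grade. -/
theorem dualGrade_dualGrade (y : X) :
    C.dualGrade (C.dualGrade y) =
      (C.mPart (C.dualGrade y) * C.mPart y) * y * (C.mPart (C.dualGrade y) * C.mPart y)⁻¹ := by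
  rw [C.dualGrade_eq (C.dualGrade y), eq_mul_inv_of_mul_eq (C.mPart_eq_absG_mul _).symm,
    C.dualGrade_eq y, eq_mul_inv_of_mul_eq (C.mPart_eq_absG_mul y).symm]
  group

theorem actM_mPart (y z : X) :
    C.actM (C.mPart y) (C.absG z) = C.mPart ((C.absG z)⁻¹ * y * C.absG z) := by
  rw [actM, C.mPart_eq_iff, C.mPart_eq_absG_mul y]
  have h : C.absG y * y * C.absG z * ((C.absG z)⁻¹ * y * C.absG z)⁻¹ = C.absG y * C.absG z := by
    group
  rw [h]
  exact C.G.mul_mem (C.absG_mem _) (C.absG_mem _)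

theorem mPart_conj_dualGrade (y : X) :
    (C.mPart y)⁻¹ * C.dualGrade y * C.mPart y = y⁻¹ := by
  conv_rhs => rw [← C.gPart_mul_mPart y]
  simp only [dualGrade]
  group

/-- The braiding acts on functionals by elements of the form `⟨y⟩⁻¹`; this converts that action into
an action on vectors. -/
theorem dualShift_mPart_inv [Finite X] [C.Admissible] (y : X) :
    C.dualShift (C.mPart y)⁻¹ y = C.rPart y := by
  have h : (C.mPart y)⁻¹ * (C.dualGrade y)⁻¹ * (C.mPart y)⁻¹⁻¹ = y := by
    have := congrArg (·⁻¹) (C.mPart_conj_dualGrade y)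
    simpa [mul_assoc] using this
  rw [dualShift, h]
  group

/-- the factors of the coevaluation, the twist, the braiding and the evaluation cancel -/
theorem trace_factors (y : X) :
    (C.mPart (C.dualGrade y) * C.mPart y)⁻¹ * (C.dualGrade (C.dualGrade y))⁻¹
      * C.absG (C.dualGrade y) * C.mPart y = 1 := by
  have h := C.gPart_mul_mPart y
  rw [C.dualGrade_dualGrade, C.mPart_eq_absG_mul (C.dualGrade y)]
  have h2 : C.dualGrade y = (C.gPart y)⁻¹ * (C.mPart y)⁻¹ := by simp [dualGrade]
  generalize C.absG (C.dualGrade y) = a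
  rw [h2]
  generalize C.gPart y = g at *
  generalize C.mPart y = m at *
  subst h
  group

/-- for the factors `δ_e ⊗ x ↦ (δ ⊗ _) ⊗ (δ_{u z u⁻¹} ⊗ u)` of the coproduct of the integral, the
group element `u` in terms of `x` and the grade `w` -/
def shear (w x : X) : X := C.absG (x * w⁻¹ * x⁻¹ * w) * x

theorem comp_shear (w x : X) :
    C.comp (C.shear w x * w * (C.shear w x)⁻¹) (x * w⁻¹ * x⁻¹ * w) = w := by
  rw [comp_eq, shear]
  group

/-- With `u = shear w x`, the grade of `δ_{u w u⁻¹} ⊗ u` is `b = x w⁻¹ x⁻¹ w`. Grades in `D` are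
unique, so `u` determines `b`, and then `x = |b|⁻¹ u`. Finiteness of `X` gives the rest. -/
theorem shear_bijective [Finite X] [C.Admissible] (w : X) : Function.Bijective (C.shear w) := by
  refine Finite.injective_iff_bijective.1 fun x x' h => ?_
  have key : ∀ x, C.gradeD (C.shear w x * w * (C.shear w x)⁻¹) (C.shear w x)
      = x * w⁻¹ * x⁻¹ * w := by
    intro x
    apply C.gradeD_eq
    rw [C.comp_shear]
    group
  have hb : x * w⁻¹ * x⁻¹ * w = x' * w⁻¹ * x'⁻¹ * w := by rw [← key x, ← key x', h]
  rw [shear, shear, hb] at h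
  exact mul_left_cancel h

theorem absG_dualGrade (y : X) :
    C.absG (C.dualGrade y) = C.mPart (C.dualGrade y) * C.mPart y * (C.absG y)⁻¹ := by
  rw [eq_mul_inv_of_mul_eq (C.mPart_eq_absG_mul (C.dualGrade y)).symm, C.dualGrade_eq y]
  group

end CosetReps

variable {k : Type u} [Field k] {X : Type v} [Group X]

theorem antipodeD_dl (C : CosetReps X) [C.Admissible] (y x : X) : antipodeD C (dl k y x)
    = dl k (C.mPart (C.gradeD y x) * x⁻¹ * y⁻¹ * x * (C.mPart (C.gradeD y x))⁻¹)
      (C.mPart (C.gradeD y x) * x⁻¹ * C.absG (C.gradeD y x)) := by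
  simp [antipodeD]

/-! ### The dual object and the braided trace -/

variable [Fintype X] [DecidableEq X] (C : CosetReps X) [C.Admissible]

/-- the identity, from the space of functionals to the underlying space of the dual object -/
def ofDual (V : Obj.{u, v, w} k X) : Module.Dual k V →ₗ[k] dualObj C V :=
  LinearMap.id (R := k) (M := Module.Dual k V)

/-- the identity, from the underlying space of the dual object to the space of functionals -/
def toDual (V : Obj.{u, v, w} k X) : dualObj C V →ₗ[k] Module.Dual k V :=
  LinearMap.id (R := k) (M := Module.Dual k V)

theorem toDual_ofDual (V : Obj.{u, v, w} k X) (α : Module.Dual k V) :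
    toDual C V (ofDual C V α) = α := rfl

theorem ev_tmul (V : Obj.{u, v, w} k X) (α : dualObj C V) (ξ : V) :
    ev C V (α ⊗ₜ ξ) = toDual C V α ξ := rfl

theorem toDual_act_proj (V : Obj.{u, v, w} k X) (g y : X) (β : dualObj C V) (ξ : V) :
    toDual C V ((dualObj C V).act g β) (V.proj y ξ)
      = toDual C V β (V.act (C.dualShift g y) (V.proj y ξ)) := by
  change ((∑ z : X, V.act (C.dualShift g z) ∘ₗ V.proj z).dualMap (toDual C V β)) _ = _
  rw [LinearMap.dualMap_apply, sum_apply_proj (F := fun z => V.act (C.dualShift g z))]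

theorem toDual_proj_proj (V : Obj.{u, v, w} k X) (l y : X) (β : dualObj C V) (ξ : V) :
    toDual C V ((dualObj C V).proj l β) (V.proj y ξ)
      = if C.dualGrade y = l then toDual C V β (V.proj y ξ) else 0 := by
  change ((∑ z : X, if C.dualGrade z = l then V.proj z else 0).dualMap (toDual C V β)) _ = _
  rw [LinearMap.dualMap_apply, proj_proj_if V (fun y => C.dualGrade y = l)]
  split_ifs <;> simp

/-- the map `ξ ↦ ξ ◁^ τ(⟨ξ⟩^L,⟨ξ⟩)⁻¹` of the coevaluation -/
def coevFactor (V : Obj.{u, v, w} k X) : V →ₗ[k] V :=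
  ∑ y : X, V.act (C.tau (C.leftInv (C.mPart y)) (C.mPart y))⁻¹ ∘ₗ V.proj y

theorem ev_braid_proj (V : Obj.{u, v, w} k X) (x : X) (ξ : V) (α : dualObj C V) :
    ev C V (braid C V (dualObj C V) (V.proj x ξ ⊗ₜ α))
      = ∑ z : X, if ((C.absG z)⁻¹ * x * C.absG z)⁻¹ = z then
          toDual C V α
            (V.act (C.absG z * C.rPart ((C.absG z)⁻¹ * x * C.absG z)) (V.proj x ξ)) else 0 := by
  have h : ev C V (braid C V (dualObj C V) (V.proj x ξ ⊗ₜ α)) = ∑ z : X,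
      toDual C V ((dualObj C V).act (C.actM (C.mPart x) (C.absG z))⁻¹
        ((dualObj C V).proj z α)) (V.act (C.absG z) (V.proj x ξ)) := by
    simp only [braid, LinearMap.comp_apply, LinearEquiv.coe_coe, TensorProduct.comm_tmul,
      LinearMap.sum_apply, TensorProduct.map_tmul, V.proj_proj, map_sum]
    rw [Finset.sum_eq_single x]
    · simp only [if_true, ev_tmul]
    · intro y _ hy
      simp [hy]
    · simp
  rw [h]
  refine Finset.sum_congr rfl fun z _ => ?_
  rw [C.actM_mPart, V.act_proj, toDual_act_proj, C.dualShift_mPart_inv, V.act_proj,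
    toDual_proj_proj, ← V.act_proj, ← V.act_proj, ← V.act_mul]
  have e : C.dualGrade ((C.rPart ((C.absG z)⁻¹ * x * C.absG z))⁻¹
      * ((C.absG z)⁻¹ * x * C.absG z) * C.rPart ((C.absG z)⁻¹ * x * C.absG z))
      = ((C.absG z)⁻¹ * x * C.absG z)⁻¹ := by
    have := (C.parts_dualShift (C.mPart ((C.absG z)⁻¹ * x * C.absG z))⁻¹
      ((C.absG z)⁻¹ * x * C.absG z)).2
    rw [C.dualShift_mPart_inv, inv_inv, C.mPart_conj_dualGrade] at this
    exact this
  rw [e]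

/-- The braided trace pairs vectors with functionals through `ev ∘ Ψ`, twisted by `θ⁻¹` and the
coevaluation factor; the twisted pairing is the plain one. On grade `y` only the component of `α` of
grade dual to `y` contributes, and there all group elements multiply to `e` by `trace_factors`. -/
theorem ev_braid_coevFactor (V : Obj.{u, v, w} k X) (ξ : V) (α : dualObj C V) :
    ev C V (braid C V (dualObj C V) (twistInv V (coevFactor C V ξ) ⊗ₜ α))
      = toDual C V α ξ := by
  have key : ∀ y ξ, ev C V (braid C V (dualObj C V) (twistInv V (coevFactor C V (V.proj y ξ)) ⊗ₜ α))
      = toDual C V α (V.proj y ξ) := by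
    intro y ξ
    set T := C.mPart (C.dualGrade y) * C.mPart y with hT
    have hv : (T⁻¹)⁻¹ * y * T⁻¹ = C.dualGrade (C.dualGrade y) := by
      rw [C.dualGrade_dualGrade, inv_inv]
    have h1 : twistInv V (coevFactor C V (V.proj y ξ))
        = V.act (T⁻¹ * (C.dualGrade (C.dualGrade y))⁻¹) (V.proj y ξ) := by
      rw [coevFactor, sum_apply_proj (F := fun y =>
        V.act (C.tau (C.leftInv (C.mPart y)) (C.mPart y))⁻¹), C.tau_leftInv, ← hT, V.act_proj,
        hv, twistInv, sum_apply_proj (F := fun y => V.act y⁻¹), V.act_mul, V.act_proj T⁻¹, hv]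
    have h2 : V.act (T⁻¹ * (C.dualGrade (C.dualGrade y))⁻¹) (V.proj y ξ)
        = V.proj (C.dualGrade (C.dualGrade y))
          (V.act (T⁻¹ * (C.dualGrade (C.dualGrade y))⁻¹) ξ) := by
      rw [V.act_mul, V.act_proj, hv, V.act_proj, V.act_mul]
      congr 2
      group
    -- The condition says that `z` and the dual grade of `y` have the same dual grade, because `|z|
    -- z⁻¹ |z|⁻¹` is the dual grade of `z`.
    have hz : ∀ z : X, ((C.absG z)⁻¹ * C.dualGrade (C.dualGrade y) * C.absG z)⁻¹ = z ↔
        z = C.dualGrade y := by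
      intro z
      rw [← C.dualGrade_injective.eq_iff (a := z), C.dualGrade_eq z, C.mPart_eq_absG_mul z]
      generalize C.dualGrade (C.dualGrade y) = d
      generalize C.absG z = a
      constructor
      · intro h
        rw [← h]
        group
      · rintro rfl
        group
    rw [h1, h2, ev_braid_proj, ← h2]
    simp only [hz, Finset.sum_ite_eq', Finset.mem_univ, if_true]
    have h3 : (C.absG (C.dualGrade y))⁻¹ * C.dualGrade (C.dualGrade y) * C.absG (C.dualGrade y)
        = (C.dualGrade y)⁻¹ := by
      rw [inv_eq_iff_eq_inv.symm]
      exact (hz _).2 rfl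
    rw [h3, C.rPart_dualGrade_inv, ← V.act_mul, ← mul_assoc, C.trace_factors, V.act_one]
  conv_lhs => rw [← V.sum_proj ξ]
  conv_rhs => rw [← V.sum_proj ξ]
  simp only [map_sum, TensorProduct.sum_tmul, key]

/-- the braided trace is the ordinary trace -/
theorem trace_eq (V : Obj.{u, v, w} k X) (f : V →ₗ[k] V) :
    trace C V f = LinearMap.trace k V f := by
  have hinj : Function.Injective (coevFactor C V) := by
    rw [← LinearMap.ker_eq_bot, LinearMap.ker_eq_bot']
    intro ξ hξ
    rw [← Module.forall_dual_apply_eq_zero_iff k]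
    intro α
    have := ev_braid_coevFactor C V ξ (ofDual C V α)
    rw [hξ, map_zero, TensorProduct.zero_tmul, map_zero, map_zero] at this
    exact this.symm
  -- With `A` the coevaluation factor, the trace becomes `∑ b^i(A⁻¹ f A b_i)`, the ordinary trace of
  -- a conjugate of `f`.
  let A := LinearEquiv.ofInjectiveEndo (coevFactor C V) hinj
  have hA : ∀ ξ, A ξ = coevFactor C V ξ := fun ξ => rfl
  let b := Module.Basis.ofVectorSpace k V
  have hc : coev C V = ∑ i, coevFactor C V (b i) ⊗ₜ ofDual C V (b.coord i) := by
    change TensorProduct.map (coevFactor C V) (ofDual C V) (coevaluation k V 1) = _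
    rw [coevaluation_apply_one, map_sum]
    rfl
  classical
  rw [← LinearMap.trace_conj' f A.symm, trace, hc, map_sum, map_sum, map_sum,
    LinearMap.trace_eq_matrix_trace k b, Matrix.trace]
  refine Finset.sum_congr rfl fun i _ => ?_
  have h := ev_braid_coevFactor C V (A.symm (f (A (b i)))) (ofDual C V (b.coord i))
  rw [← hA, A.apply_symm_apply, toDual_ofDual] at h
  refine h.trans ?_
  rw [Matrix.diag_apply, LinearMap.toMatrix_apply]
  rfl

/-! ### Right integrals -/

theorem mulD_dl_one (h : DAlg k X) (z : X) :
    mulD C h (dl k 1 z) = ∑ x : X, h (1, x) • dl k 1 (x * z) := by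
  induction h using Finsupp.induction_linear with
  | zero => simp
  | add f g hf hg =>
    simp only [map_add, LinearMap.add_apply, hf, hg, Finsupp.add_apply, add_smul,
      Finset.sum_add_distrib]
  | single a r =>
    obtain ⟨y, x⟩ := a
    simp only [mulD, Finsupp.linearCombination_single, LinearMap.smul_apply, one_smul]
    by_cases hy : y = 1
    · subst hy
      rw [Finset.sum_eq_single x]
      · simp [C.gradeD_one_left, C.parts_one, CosetReps.tau]
      · intro b _ hb
        simp [hb.symm]
      · simp
    · have h1 : ¬ (1 = x⁻¹ * y * x) := by
        intro h
        apply hy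
        have : y = x * (x⁻¹ * y * x) * x⁻¹ := by group
        rw [this, ← h]
        group
      simp [h1, hy]

/-- a right integral is a multiple of `∑ δ_e ⊗ x` -/
theorem IsRightIntegral.eq_smul_sum {L : DAlg k X} (hL : IsRightIntegral C L) :
    L = L (1, 1) • ∑ x : X, dl k 1 x := by
  have hz : ∀ z : X, ∑ x : X, L (1, x) • dl k 1 (x * z) = L := by
    intro z
    rw [← mulD_dl_one C, hL.2]
    simp [counitD]
  -- Compare the coefficients of `δ_e ⊗ z`: in `hz z` only `x = e` contributes.
  have hc : ∀ z : X, L (1, z) = L (1, 1) := by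
    intro z
    conv_lhs => rw [← hz z]
    rw [Finsupp.finsetSum_apply, Finset.sum_eq_single 1]
    · simp
    · intro x _ hx
      simp [hx]
    · simp
  conv_lhs => rw [← hz 1]
  simp only [hc, mul_one, Finset.smul_sum]

theorem IsRightIntegral.card_mul {L : DAlg k X} (hL : IsRightIntegral C L)
    (hε : counitD L = 1) : L (1, 1) * Fintype.card X = 1 := by
  have h := hε
  rw [hL.eq_smul_sum] at h
  simpa [counitD] using h

/-! ### Averaging over the group and morphisms of representations -/

/-- the part of a linear map which preserves the grades -/
def gradedPart {V : Obj.{u, v, w} k X} {W : Obj.{u, v, w'} k X} (t : V →ₗ[k] W) : V →ₗ[k] W :=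
  ∑ y : X, W.proj y ∘ₗ t ∘ₗ V.proj y

/-- the sum of all conjugates under `X` of the grade preserving part of a linear map -/
def conjSum {V : Obj.{u, v, w} k X} {W : Obj.{u, v, w'} k X} (t : V →ₗ[k] W) : V →ₗ[k] W :=
  ∑ x : X, W.act x ∘ₗ gradedPart t ∘ₗ V.act x⁻¹

theorem gradedPart_proj {V : Obj.{u, v, w} k X} {W : Obj.{u, v, w'} k X} (t : V →ₗ[k] W)
    (y : X) (ξ : V) : gradedPart t (V.proj y ξ) = W.proj y (t (V.proj y ξ)) :=
  sum_apply_proj V (fun y => W.proj y ∘ₗ t) y ξ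

theorem conjSum_proj {V : Obj.{u, v, w} k X} {W : Obj.{u, v, w'} k X} (t : V →ₗ[k] W)
    (y : X) (ξ : V) : conjSum t (V.proj y ξ) = W.proj y (conjSum t (V.proj y ξ)) := by
  simp only [conjSum, LinearMap.sum_apply, LinearMap.comp_apply, map_sum]
  refine Finset.sum_congr rfl fun x _ => ?_
  rw [V.act_proj, gradedPart_proj, W.act_proj, W.proj_proj, if_pos]
  group

theorem conjSum_act {V : Obj.{u, v, w} k X} {W : Obj.{u, v, w'} k X} (t : V →ₗ[k] W)
    (z : X) (ξ : V) : conjSum t (V.act z ξ) = W.act z (conjSum t ξ) := by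
  simp only [conjSum, LinearMap.sum_apply, LinearMap.comp_apply, map_sum]
  refine Fintype.sum_equiv (Equiv.mulRight z⁻¹) _ _ fun x => ?_
  simp [← V.act_mul, ← W.act_mul]

theorem actD_tmul_dl (V : Obj.{u, v, w} k X) (ξ : V) (y x : X) :
    actD V (ξ ⊗ₜ dl k y x) = V.act x (V.proj y ξ) := by
  simp [actD]

theorem isMorphism_of_commute {V : Obj.{u, v, w} k X} {W : Obj.{u, v, w'} k X} {f : V →ₗ[k] W}
    (hp : ∀ y ξ, f (V.proj y ξ) = W.proj y (f ξ)) (ha : ∀ x ξ, f (V.act x ξ) = W.act x (f ξ)) :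
    IsMorphism f := by
  intro ξ h
  induction h using Finsupp.induction_linear with
  | zero => simp
  | add a b iha ihb => simp only [TensorProduct.tmul_add, map_add, iha, ihb]
  | single a r =>
    have : (Finsupp.single a r : DAlg k X) = r • dl k a.1 a.2 := by simp
    rw [this]
    simp only [TensorProduct.tmul_smul, map_smul, actD_tmul_dl, hp, ha]

theorem isMorphism_smul_conjSum {V : Obj.{u, v, w} k X} {W : Obj.{u, v, w'} k X} (r : k)
    (t : V →ₗ[k] W) : IsMorphism (r • conjSum t) := by
  refine isMorphism_of_commute (fun y ξ => ?_) fun x ξ => ?_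
  · rw [LinearMap.smul_apply, LinearMap.smul_apply, map_smul]
    congr 1
    conv_rhs => rw [← V.sum_proj ξ]
    simp only [map_sum]
    rw [Finset.sum_eq_single y]
    · rw [← conjSum_proj]
    · intro z _ hz
      rw [conjSum_proj, W.proj_proj, if_neg hz.symm]
    · simp
  · simp only [LinearMap.smul_apply, map_smul, conjSum_act]

/-! ### The average against an integral -/

/-- the identity, from `D` to the underlying space of `D` as an object of `𝒟` -/
def ofD : DAlg k X →ₗ[k] dObj C k := LinearMap.id (R := k) (M := DAlg k X)

theorem dObj_proj_dl (b y x : X) : (dObj C k).proj b (ofD C (dl k y x))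
      = if C.gradeD y x = b then ofD C (dl k y x) else 0 := by
  have h : Finsupp.linearCombination k (fun a : X × X =>
      if C.gradeD a.1 a.2 = b then dl k a.1 a.2 else 0) (dl k y x)
      = if C.gradeD y x = b then dl k y x else 0 := by simp
  have h' := congrArg (ofD C) h
  rw [apply_ite (ofD C), map_zero] at h'
  exact h'

theorem assocInv_dl (V : Obj.{u, v, w} k X) (ξ : V) (y x y' x' : X) :
    assocInv C V (dObj C k) (dObj C k) (ξ ⊗ₜ (ofD C (dl k y x) ⊗ₜ ofD C (dl k y' x')))
      = (V.act (C.tau (C.mPart (C.gradeD y x)) (C.mPart (C.gradeD y' x')))⁻¹ ξ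
          ⊗ₜ ofD C (dl k y x)) ⊗ₜ ofD C (dl k y' x') := by
  rw [assocInv, LinearMap.comp_apply, LinearEquiv.coe_coe, TensorProduct.assoc_symm_tmul]
  simp only [LinearMap.sum_apply, TensorProduct.map_tmul, dObj_proj_dl]
  rw [Finset.sum_eq_single (C.gradeD y x), Finset.sum_eq_single (C.gradeD y' x')]
  · rw [if_pos rfl, if_pos rfl]
  · intro c _ hc
    rw [if_neg hc.symm, TensorProduct.tmul_zero]
  · simp
  · intro b _ hb
    refine Finset.sum_eq_zero fun c _ => ?_
    rw [if_neg hb.symm, TensorProduct.tmul_zero, TensorProduct.zero_tmul]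
  · simp

/-- the part of the average after the coproduct, `ξ ⊗ (g ⊗ h) ↦ t(ξ ◁ S(g)) ◁ h` -/
def averageTail {V : Obj.{u, v, w} k X} {W : Obj.{u, v, w'} k X} (t : V →ₗ[k] W) :
    V ⊗[k] (DAlg k X ⊗[k] DAlg k X) →ₗ[k] W :=
  actD W
    ∘ₗ TensorProduct.map t LinearMap.id
    ∘ₗ TensorProduct.map (actD V) LinearMap.id
    ∘ₗ assocInv C V (dObj C k) (dObj C k)
    ∘ₗ TensorProduct.map LinearMap.id (TensorProduct.map (antipodeD C) LinearMap.id)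

theorem average_apply {V : Obj.{u, v, w} k X} {W : Obj.{u, v, w'} k X} (t : V →ₗ[k] W)
    (L : DAlg k X) (ξ : V) :
    average C L t ξ = averageTail C t (ξ ⊗ₜ comulD C L) := rfl

theorem averageTail_dl {V : Obj.{u, v, w} k X} {W : Obj.{u, v, w'} k X} (t : V →ₗ[k] W)
    (ξ : V) (y x y' x' y'' x'' : X) (h : antipodeD C (dl k y x) = dl k y'' x'') :
    averageTail C t (ξ ⊗ₜ (dl k y x ⊗ₜ dl k y' x'))
      = W.act x' (W.proj y' (t (V.act x'' (V.proj y''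
        (V.act (C.tau (C.mPart (C.gradeD y'' x'')) (C.mPart (C.gradeD y' x')))⁻¹ ξ))))) := by
  have e : averageTail C t (ξ ⊗ₜ (dl k y x ⊗ₜ dl k y' x'))
      = actD W (TensorProduct.map t LinearMap.id (TensorProduct.map (actD V) LinearMap.id
        (assocInv C V (dObj C k) (dObj C k)
          (ξ ⊗ₜ (ofD C (antipodeD C (dl k y x)) ⊗ₜ ofD C (dl k y' x')))))) := rfl
  rw [e, h, assocInv_dl]
  change actD W (t (actD V (_ ⊗ₜ dl k y'' x'')) ⊗ₜ dl k y' x') = _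
  rw [actD_tmul_dl, actD_tmul_dl]

omit [DecidableEq X] in
-- As `δ_e ⊗ x` has grade `e`, the grades of its two tensor factors are dual to each other. The
-- associator factor `T` is then `⟨a⟩⟨b⟩` itself, and `r = |b|⁻¹`.
theorem comulD_dl_one (x : X) :
    comulD C (dl k 1 x) = ∑ z : X,
      let b := z⁻¹ * x⁻¹ * z * x
      let T := C.mPart (C.dualGrade b) * C.mPart b
      dl k (T * z⁻¹ * T⁻¹) (T * x * (C.mPart b)⁻¹)
        ⊗ₜ[k] dl k (C.absG b * z * (C.absG b)⁻¹) (C.absG b * x) := by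
  simp only [comulD, Finsupp.linearCombination_single, one_smul]
  refine Finset.sum_congr rfl fun z _ => ?_
  have h1 : C.absG 1 = 1 := by simp [CosetReps.absG, C.parts_one]
  rw [C.gradeD_one_left, h1]
  simp only [inv_one, one_mul, mul_one]
  generalize z⁻¹ * x⁻¹ * z * x = b
  rw [← C.dualGrade_eq b]
  have hT : C.tau (C.mPart (C.dualGrade b)) (C.mPart b)
      = C.mPart (C.dualGrade b) * C.mPart b := by
    rw [← C.tau_leftInv, C.mPart_dualGrade]
  rw [hT]
  have hr : (C.mPart (C.dualGrade b) * C.mPart b)⁻¹ * C.absG (C.dualGrade b)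
      = (C.absG b)⁻¹ := by
    rw [C.absG_dualGrade]
    group
  rw [hr, inv_inv]

theorem average_dl_one {V : Obj.{u, v, w} k X} {W : Obj.{u, v, w'} k X} (t : V →ₗ[k] W)
    (x w : X) (ξ : V) :
    average C (dl k 1 x) t (V.proj w ξ)
      = W.act (C.shear w x) (gradedPart t (V.act (C.shear w x)⁻¹ (V.proj w ξ))) := by
  rw [average_apply, comulD_dl_one, TensorProduct.tmul_sum, map_sum]
  have hz : ∀ z : X, averageTail C t (V.proj w ξ ⊗ₜ
      (let b := z⁻¹ * x⁻¹ * z * x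
      let T := C.mPart (C.dualGrade b) * C.mPart b
      dl k (T * z⁻¹ * T⁻¹) (T * x * (C.mPart b)⁻¹)
        ⊗ₜ[k] dl k (C.absG b * z * (C.absG b)⁻¹) (C.absG b * x)))
      = if x⁻¹ * z * x = w then
          W.act (C.shear w x) (gradedPart t (V.act (C.shear w x)⁻¹ (V.proj w ξ))) else 0 := by
    intro z
    obtain ⟨b, hb⟩ : ∃ b, b = z⁻¹ * x⁻¹ * z * x := ⟨_, rfl⟩
    have hxz : x⁻¹ * z * x = z * b := by rw [hb]; group
    obtain ⟨T, hT⟩ : ∃ T, T = C.mPart (C.dualGrade b) * C.mPart b := ⟨_, rfl⟩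
    have hd := C.absG_dualGrade b
    have hdm := C.mPart_eq_absG_mul b
    rw [← hT] at hd
    have hdm' : C.mPart (C.dualGrade b) = T * (C.mPart b)⁻¹ := by rw [hT]; group
    have h1 : C.gradeD (T * z⁻¹ * T⁻¹) (T * x * (C.mPart b)⁻¹) = C.dualGrade b := by
      apply C.gradeD_eq
      rw [CosetReps.comp, ← C.absG_inv, hd, hdm', hdm, hb]
      group
    have h2 : C.gradeD (C.absG b * z * (C.absG b)⁻¹) (C.absG b * x) = b := by
      apply C.gradeD_eq
      rw [C.comp_eq]
      have : (C.absG b)⁻¹ * (C.absG b * z * (C.absG b)⁻¹) * (C.absG b * b) = z * b := by group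
      rw [this, ← hxz]
      group
    have h3 : antipodeD C (dl k (T * z⁻¹ * T⁻¹) (T * x * (C.mPart b)⁻¹))
        = dl k (T * (x⁻¹ * z * x) * T⁻¹) (T * x⁻¹ * (C.absG b)⁻¹) := by
      rw [antipodeD_dl, h1, hd, hdm']
      refine congrArg (fun p : X × X => Finsupp.single p (1 : k)) (Prod.ext ?_ ?_) <;>
        dsimp only <;> group
    -- The antipode preserves the grade, so the inverse associator again contributes `T⁻¹`.
    have h4 : C.gradeD (T * (x⁻¹ * z * x) * T⁻¹) (T * x⁻¹ * (C.absG b)⁻¹) = C.dualGrade b := by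
      apply C.gradeD_eq
      rw [CosetReps.comp, ← C.absG_inv, hd, hdm', hxz, hdm]
      have : z = x * (z * b) * x⁻¹ := by rw [← hxz]; group
      have e : (T * x⁻¹ * (C.absG b)⁻¹)⁻¹ * (T * (z * b) * T⁻¹) * (T * x⁻¹ * (C.absG b)⁻¹)
          = C.absG b * (x * (z * b) * x⁻¹) * (C.absG b)⁻¹ := by group
      rw [e, ← this]
      group
    dsimp only
    rw [← hb, ← hT, averageTail_dl C t _ _ _ _ _ _ _ h3, h4, h2]
    have h5 : C.tau (C.mPart (C.dualGrade b)) (C.mPart b) = T := by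
      rw [hT, ← C.tau_leftInv, C.mPart_dualGrade]
    rw [h5, V.act_proj T⁻¹, V.proj_proj]
    -- Acting by `T⁻¹` moves the grade `w` to `T w T⁻¹`, so exactly one summand of the coproduct
    -- survives.
    have hiff : T * (x⁻¹ * z * x) * T⁻¹ = T⁻¹⁻¹ * w * T⁻¹ ↔ x⁻¹ * z * x = w := by
      rw [inv_inv, mul_left_inj, mul_right_inj]
    simp only [hiff]
    by_cases h : x⁻¹ * z * x = w
    · rw [if_pos h, if_pos h, ← V.act_proj, ← V.act_mul]
      have hbw : b = x * w⁻¹ * x⁻¹ * w := by rw [hb, ← h]; group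
      have hs : C.shear w x = C.absG b * x := by rw [hbw]; rfl
      have e1 : T⁻¹ * (T * x⁻¹ * (C.absG b)⁻¹) = (C.shear w x)⁻¹ := by rw [hs]; group
      -- The second factor of the coproduct projects onto the grade of `ξ ◁^ u⁻¹`, where `u = shear
      -- w x`; this is what replaces `t` by its grade-preserving part.
      have e2 : C.absG b * z * (C.absG b)⁻¹ = (C.shear w x)⁻¹⁻¹ * w * (C.shear w x)⁻¹ := by
        rw [hs, ← h]; group
      rw [e1, e2, ← hs, V.act_proj, gradedPart_proj]
    · rw [if_neg h, if_neg h]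
      simp only [map_zero]
  rw [Finset.sum_congr rfl fun z _ => hz z, Finset.sum_eq_single (x * w * x⁻¹)]
  · rw [if_pos]
    group
  · intro z _ hne
    rw [if_neg]
    rintro rfl
    apply hne
    group
  · simp

theorem IsRightIntegral.average_eq {L : DAlg k X} (hL : IsRightIntegral C L)
    {V : Obj.{u, v, w} k X} {W : Obj.{u, v, w'} k X} (t : V →ₗ[k] W) :
    average C L t = L (1, 1) • conjSum t := by
  refine ext_proj fun w ξ => ?_
  have h : average C L t (V.proj w ξ)
      = L (1, 1) • ∑ x : X, average C (dl k 1 x) t (V.proj w ξ) := by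
    simp only [average_apply]
    conv_lhs => rw [hL.eq_smul_sum C]
    simp only [map_smul, map_sum, TensorProduct.tmul_smul, TensorProduct.tmul_sum]
  rw [h]
  simp only [average_dl_one, conjSum, LinearMap.smul_apply, LinearMap.sum_apply,
    LinearMap.comp_apply]
  congr 1
  exact (C.shear_bijective w).sum_comp (fun u => W.act u (gradedPart t (V.act u⁻¹ (V.proj w ξ))))

/-! ### Ordinary traces of averages -/

/-- By cyclicity and idempotence, `tr(p t p) = tr(t p)` for each projection `p`, and the projections
sum to the identity. -/
theorem trace_gradedPart {V : Obj.{u, v, w} k X} (t : V →ₗ[k] V) :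
    LinearMap.trace k V (gradedPart t) = LinearMap.trace k V t := by
  have h1 : ∀ y, LinearMap.trace k V (V.proj y ∘ₗ t ∘ₗ V.proj y)
      = LinearMap.trace k V (t ∘ₗ V.proj y) := by
    intro y
    rw [LinearMap.trace_comp_comm', LinearMap.comp_assoc]
    congr 2
    ext ξ
    simp [V.proj_proj]
  have h2 : (∑ y, t ∘ₗ V.proj y) = t := by
    ext ξ
    rw [LinearMap.sum_apply]
    simp only [LinearMap.comp_apply]
    rw [← map_sum, V.sum_proj]
  rw [gradedPart, map_sum]
  simp only [h1]
  rw [← map_sum, h2]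

theorem trace_conjSum {V : Obj.{u, v, w} k X} (t : V →ₗ[k] V) :
    LinearMap.trace k V (conjSum t) = Fintype.card X * LinearMap.trace k V t := by
  have h1 : ∀ x, LinearMap.trace k V (V.act x ∘ₗ gradedPart t ∘ₗ V.act x⁻¹)
      = LinearMap.trace k V t := by
    intro x
    rw [LinearMap.trace_comp_comm', LinearMap.comp_assoc, ← trace_gradedPart t]
    congr 1
    ext ξ
    simp [← V.act_mul, V.act_one]
  rw [conjSum, map_sum]
  simp [h1]

/-! ### Schur's lemma and the conclusion -/

theorem IsMorphism.isSubrep_ker {V : Obj.{u, v, w} k X} {W : Obj.{u, v, w'} k X} {f : V →ₗ[k] W}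
    (hf : IsMorphism f) : IsSubrep V (LinearMap.ker f) := by
  intro ξ hξ h
  rw [LinearMap.mem_ker] at *
  rw [hf, hξ, TensorProduct.zero_tmul, map_zero]

theorem IsMorphism.isSubrep_range {V : Obj.{u, v, w} k X} {W : Obj.{u, v, w'} k X}
    {f : V →ₗ[k] W} (hf : IsMorphism f) : IsSubrep W (LinearMap.range f) := by
  rintro _ ⟨ξ, rfl⟩ h
  exact ⟨_, hf ξ h⟩

/-- Schur's lemma: a non-zero morphism of irreducible representations is bijective -/
theorem IsMorphism.bijective {V : Obj.{u, v, w} k X} {W : Obj.{u, v, w'} k X} {f : V →ₗ[k] W}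
    (hf : IsMorphism f) (hV : IsIrreducible V) (hW : IsIrreducible W) (h0 : f ≠ 0) :
    Function.Bijective f := by
  constructor
  · rcases hV.2 _ hf.isSubrep_ker with h | h
    · exact LinearMap.ker_eq_bot.1 h
    · exact absurd (LinearMap.ker_eq_top.1 h) h0
  · rcases hW.2 _ hf.isSubrep_range with h | h
    · exact absurd (LinearMap.range_eq_bot.1 h) h0
    · exact LinearMap.range_eq_top.1 h

/-- Schur's lemma over an algebraically closed field -/
theorem IsMorphism.eq_smul_id [IsAlgClosed k] {V : Obj.{u, v, w} k X} {f : V →ₗ[k] V}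
    (hf : IsMorphism f) (hV : IsIrreducible V) : ∃ r : k, f = r • LinearMap.id := by
  have := hV.1
  obtain ⟨r, hr⟩ := Module.End.exists_eigenvalue (K := k) f
  refine ⟨r, ?_⟩
  -- If non-zero, this morphism would be injective, yet it kills an eigenvector.
  have hg : IsMorphism (f - r • LinearMap.id) := by
    intro ξ h
    simp only [LinearMap.sub_apply, LinearMap.smul_apply, LinearMap.id_apply, hf ξ h,
      TensorProduct.sub_tmul, map_sub, ← TensorProduct.smul_tmul', map_smul]
  by_contra h0
  obtain ⟨ξ, hξ⟩ := hr.exists_hasEigenvector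
  refine hξ.2 ((hg.bijective hV hV (sub_ne_zero.2 h0)).1 ?_)
  simp [hξ.apply_eq_smul]

theorem exists_trace_eq_one {V : Type*} [AddCommGroup V] [Module k V] [Module.Finite k V]
    [Nontrivial V] : ∃ f : V →ₗ[k] V, LinearMap.trace k V f = 1 := by
  obtain ⟨ξ, hξ⟩ := exists_ne (0 : V)
  obtain ⟨α, hα⟩ := Module.Projective.exists_dual_eq_one k hξ
  exact ⟨dualTensorHom k V V (α ⊗ₜ ξ), by rw [LinearMap.trace_eq_contract_apply]; simp [hα]⟩

end CosetCat

end

theorem mainTheorem2 {k : Type*} [Field k] {X : Type*} [Group X] [Fintype X] [DecidableEq X]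
    (C : CosetCat.CosetReps X) [C.Admissible]
    (L : CosetCat.DAlg k X) (hL : CosetCat.IsRightIntegral C L) (hε : CosetCat.counitD L = 1) :
    (∀ (V : CosetCat.Obj k X) (W : CosetCat.Obj k X),
      CosetCat.IsIrreducible V → CosetCat.IsIrreducible W → ¬ CosetCat.Isomorphic V W →
      ∀ t : V →ₗ[k] W, CosetCat.average C L t = 0) ∧
    (∀ V : CosetCat.Obj k X, CosetCat.IsIrreducible V →
      (IsAlgClosed k ∨
        ∀ f : V →ₗ[k] V, CosetCat.IsMorphism f → ∃ r : k, f = r • LinearMap.id) →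
      CosetCat.dim C V ≠ 0 ∧ ∀ t : V →ₗ[k] V,
        CosetCat.average C L t = (CosetCat.trace C V t / CosetCat.dim C V) • LinearMap.id) := by
  constructor
  · intro V W hV hW hVW t
    rw [hL.average_eq]
    by_contra h0
    have hm := CosetCat.isMorphism_smul_conjSum (L (1, 1)) t
    exact hVW ⟨LinearEquiv.ofBijective _ (hm.bijective hV hW h0), hm⟩
  · intro V hV hk
    have hs : ∀ f : V →ₗ[k] V, CosetCat.IsMorphism f → ∃ r : k, f = r • LinearMap.id := by
      rcases hk with hk | hk
      · exact fun f hf => hf.eq_smul_id hV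
      · exact hk
    have key : ∀ t : V →ₗ[k] V, ∃ r : k, CosetCat.average C L t = r • LinearMap.id ∧
        r * CosetCat.dim C V = CosetCat.trace C V t := by
      intro t
      obtain ⟨r, hr⟩ := hs _ (CosetCat.isMorphism_smul_conjSum (L (1, 1)) t)
      refine ⟨r, by rw [hL.average_eq, hr], ?_⟩
      -- Taking ordinary traces, the factor `|X|` from the sum of conjugates cancels against the
      -- coefficient of the integral.
      have h := congrArg (LinearMap.trace k V) hr
      rw [map_smul, map_smul, CosetCat.trace_conjSum, smul_eq_mul, smul_eq_mul, ← mul_assoc,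
        hL.card_mul C hε, one_mul] at h
      rw [CosetCat.dim, CosetCat.trace_eq, CosetCat.trace_eq, h]
    have hd : CosetCat.dim C V ≠ 0 := by
      have := hV.1
      -- A map of trace `1` turns the relation into `r dim V = 1`.
      obtain ⟨t, ht⟩ := CosetCat.exists_trace_eq_one (k := k) (V := V)
      obtain ⟨r, -, hr⟩ := key t
      rw [CosetCat.trace_eq, ht] at hr
      intro h0
      rw [h0, mul_zero] at hr
      exact zero_ne_one hr
    refine ⟨hd, fun t => ?_⟩
    obtain ⟨r, h1, h2⟩ := key t
    rw [h1, ← h2, mul_div_cancel_right₀ _ hd]
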